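/- Consider the linear $\lambda$-calculus with types $A ::= a \mid A_1 \otimes A_2 \mid A_1 \multimap A_2$ ($a$ ranging over countably many type variables) and terms $t ::= x \mid t\,s \mid \lambda x.t \mid (s,t) \mid \mathsf{let}\ (x,y)=s\ \mathsf{in}\ t$, taken up to renaming of bound variables. The typing rules are the usual natural deduction rules of intuitionistic multiplicative linear logic (contexts are unordered, the contexts of the premises of a rule are disjoint, and there is no weakening or contraction). A closed term of $A$ is a term $s$ with $\vdash s : A$. The typed equality $\Gamma \vdash t =_{\beta\eta c} s : A$ is the least congruent equivalence relation on typed terms which contains, for $\Gamma\vdash t:A$, every commutative conversion $t \leftrightarrow_c t'$ and every reduction $t \to_{\beta\eta c} t'$. Here $\leftrightarrow_c$ relates, in both directions, $C[\mathsf{let}\ (x,y)=t\ \mathsf{in}\ u]$ and $\mathsf{let}\ (x,y)=t\ \mathsf{in}\ C[u]$, for every one-hole context $C$ in which $x,y$ are not free and which captures no free variable of $t$; $=_c$ is the congruent equivalence relation generated by $\leftrightarrow_c$; and $\to_{\beta\eta c}$ is one step, in any context and modulo $=_c$ before and after, of one of the rules $(\lambda x.t)s \Rightarrow t[s/x]$,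 $\ \mathsf{let}\ (x,y)=(u,v)\ \mathsf{in}\ w \Rightarrow w[u/x,v/y]$, $\ \lambda x.(t\,x)\Rightarrow t$ (with $x$ not free in $t$), $\ \mathsf{let}\ (x,y)=t\ \mathsf{in}\ (x,y) \Rightarrow t$. A type $P$ is a principal type of $t$ if $\Gamma\vdash t:P$ for some $\Gamma$ such that, whenever $\Gamma'\vdash t:A'$, there is a type substitution $\theta$ with $A'=\theta(P)$ and $\Gamma'=\theta(\Gamma)$; principal types are determined up to renaming of type variables. Let $t, s_1,\dots,s_n$ be closed terms such that $\vdash t : A_1'\multimap\cdots\multimap A_n'\multimap B'$ for some types $A_i',B'$ and $\vdash s_i:A_i$. Then $t$ is poly-typable by $A_1\multimap\cdots\multimap A_n\multimap B$ with respect to $s_1,\dots,s_n$ if there are principal types $P$ of $t$ and $Q_i$ of $s_i$, a type substitution $\theta$ and types $A_1'',\dots,A_n''$ with $\theta(P)=A_1''\multimap\cdots\multimap A_n''\multimap B$ and $\theta(Q_i)=A_i''$ for all $i$. (1) (Constant Function Lemma) Let $A$ and $B$ be types having at least one closed term, and let $u$ be a closed term of $B$. Then there is a closed term $t$ such that, for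 every closed term $s$ of $A$, $t$ is poly-typable by $A\multimap B$ with respect to $s$ and $\vdash t\,s =_{\beta\eta c} u : B$. (2) (Corollary) Let $A$ be a type and $v$ a closed term of $A$. For every $n\ge 0$ there is a closed term $t$ such that, for all closed terms $s_1,\dots,s_n$ of $A$, $t$ is poly-typable by $\underbrace{A\multimap\cdots\multimap A}_{n}\multimap A$ with respect to $s_1,\dots,s_n$ and $\vdash t\,s_1\cdots s_n =_{\beta\eta c} v : A$. -/

import Mathlib

namespace LinLam

/-- Types of the linear lambda calculus: type variables, tensor products `A * B`
and linear implications `A -> B`. -/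
inductive Ty : Type
  | var (a : ℕ) : Ty
  | tensor (A B : Ty) : Ty
  | lolli (A B : Ty) : Ty

/-- The unique extension to types of a type substitution `θ`. -/
def Ty.subst (θ : ℕ → Ty) : Ty → Ty
  | .var a => θ a
  | .tensor A B => .tensor (A.subst θ) (B.subst θ)
  | .lolli A B => .lolli (A.subst θ) (B.subst θ)

/-- `A₁ -> ⋯ -> Aₙ -> B`. -/
def Ty.arrows (As : List Ty) (B : Ty) : Ty := As.foldr Ty.lolli B

/-- Untyped terms up to renaming of bound variables, with de Bruijn indices.
`lam t` is `fn x => t`, where index `0` of `t` is `x`;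
`letp s t` is `let val (x, y) = s in t end`, where index `0` of `t` is `x` and index `1` is `y`. -/
inductive Tm : Type
  | var (i : ℕ) : Tm
  | app (t s : Tm) : Tm
  | lam (t : Tm) : Tm
  | pair (s t : Tm) : Tm
  | letp (s t : Tm) : Tm

/-- A renaming carried under one binder. -/
def liftRen (ρ : ℕ → ℕ) : ℕ → ℕ
  | 0 => 0
  | i + 1 => ρ i + 1

namespace Tm

def rename : (ℕ → ℕ) → Tm → Tm
  | ρ, var i => var (ρ i)
  | ρ, app t s => app (t.rename ρ) (s.rename ρ)
  | ρ, lam t => lam (t.rename (liftRen ρ))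
  | ρ, pair s t => pair (s.rename ρ) (t.rename ρ)
  | ρ, letp s t => letp (s.rename ρ) (t.rename (liftRen (liftRen ρ)))

/-- A substitution carried under one binder. -/
def liftSub (σ : ℕ → Tm) : ℕ → Tm
  | 0 => var 0
  | i + 1 => (σ i).rename Nat.succ

/-- Simultaneous capture-avoiding substitution. -/
def subst : (ℕ → Tm) → Tm → Tm
  | σ, var i => σ i
  | σ, app t s => app (t.subst σ) (s.subst σ)
  | σ, lam t => lam (t.subst (liftSub σ))
  | σ, pair s t => pair (s.subst σ) (t.subst σ)
  | σ, letp s t => letp (s.subst σ) (t.subst (liftSub (liftSub σ)))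

/-- `t[s/x]`, where `x` is index `0`. -/
def inst1 (t s : Tm) : Tm :=
  t.subst fun i => match i with
    | 0 => s
    | j + 1 => var j

/-- `w[u/x, v/y]`, where `x` is index `0` and `y` is index `1`. -/
def inst2 (w u v : Tm) : Tm :=
  w.subst fun i => match i with
    | 0 => u
    | 1 => v
    | j + 2 => var j

/-- `t s₁ ⋯ sₙ`. -/
def apps (t : Tm) (ss : List Tm) : Tm := ss.foldl app t

end Tm

/-- Linear typing contexts, as partial maps from variables to types. They are unordered, so that
the exchange rule is built in; only finite ones occur in derivations. -/
abbrev Ctx : Type := ℕ → Option Ty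

namespace Ctx

def empty : Ctx := fun _ => none

/-- The context `x : A`, where `x` is index `i`. -/
def single (i : ℕ) (A : Ty) : Ctx := fun j => if j = i then some A else none

/-- The context `x : A, Γ`, where `x` is the new index `0`. -/
def cons (A : Ty) (Γ : Ctx) : Ctx
  | 0 => some A
  | i + 1 => Γ i

/-- `Ξ` is the context `Γ, Δ`; no variable is declared both in `Γ` and in `Δ`. -/
def Merge (Γ Δ Ξ : Ctx) : Prop :=
  ∀ i, (Γ i = none ∧ Ξ i = Δ i) ∨ (Δ i = none ∧ Ξ i = Γ i)

/-- The context `Γ` with the type substitution `θ` applied to every type in it. -/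
def subst (θ : ℕ → Ty) (Γ : Ctx) : Ctx := fun i => (Γ i).map (Ty.subst θ)

end Ctx

/-- The type assignment system: `HasType Γ t A` is `Γ ⊢ t : A`. -/
inductive HasType : Ctx → Tm → Ty → Prop
  | var (i : ℕ) (A : Ty) : HasType (Ctx.single i A) (Tm.var i) A
  | lam {Γ : Ctx} {t : Tm} {A B : Ty} :
      HasType (Ctx.cons A Γ) t B → HasType Γ (Tm.lam t) (Ty.lolli A B)
  | app {Γ Δ Ξ : Ctx} {t s : Tm} {A B : Ty} :
      Ctx.Merge Γ Δ Ξ → HasType Γ t (Ty.lolli A B) → HasType Δ s A →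
      HasType Ξ (Tm.app t s) B
  | pair {Γ Δ Ξ : Ctx} {s t : Tm} {A B : Ty} :
      Ctx.Merge Γ Δ Ξ → HasType Γ s A → HasType Δ t B →
      HasType Ξ (Tm.pair s t) (Ty.tensor A B)
  | letp {Γ Δ Ξ : Ctx} {s t : Tm} {A B C : Ty} :
      Ctx.Merge Γ Δ Ξ → HasType Γ s (Ty.tensor A B) →
      HasType (Ctx.cons A (Ctx.cons B Δ)) t C →
      HasType Ξ (Tm.letp s t) C

/-- `s` is a closed term of the type `A`, i.e. `⊢ s : A`. -/
def ClosedOf (s : Tm) (A : Ty) : Prop := HasType Ctx.empty s A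

/-- `A` has at least one closed term. -/
def Ty.HasClosedTerm (A : Ty) : Prop := ∃ s, ClosedOf s A

/-- Term contexts `C[]` with exactly one hole. -/
inductive TmCtx : Type
  | hole : TmCtx
  | appL (C : TmCtx) (t : Tm) : TmCtx
  | appR (t : Tm) (C : TmCtx) : TmCtx
  | pairL (C : TmCtx) (t : Tm) : TmCtx
  | pairR (t : Tm) (C : TmCtx) : TmCtx
  | lam (C : TmCtx) : TmCtx
  | letL (C : TmCtx) (t : Tm) : TmCtx
  | letR (t : Tm) (C : TmCtx) : TmCtx

namespace TmCtx

/-- `C[t]`; the binders of `C` above the hole capture the lowest indices of `t`. -/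
def plug : TmCtx → Tm → Tm
  | hole, r => r
  | appL C t, r => Tm.app (C.plug r) t
  | appR t C, r => Tm.app t (C.plug r)
  | pairL C t, r => Tm.pair (C.plug r) t
  | pairR t C, r => Tm.pair t (C.plug r)
  | lam C, r => Tm.lam (C.plug r)
  | letL C t, r => Tm.letp (C.plug r) t
  | letR t C, r => Tm.letp t (C.plug r)

/-- The number of variables captured by `C[]`. -/
def depth : TmCtx → ℕ
  | hole => 0
  | appL C _ => C.depth
  | appR _ C => C.depth
  | pairL C _ => C.depth
  | pairR _ C => C.depth
  | lam C => C.depth + 1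
  | letL C _ => C.depth
  | letR _ C => C.depth + 2

/-- Renaming of the free variables of a context. -/
def rename : (ℕ → ℕ) → TmCtx → TmCtx
  | _, hole => hole
  | ρ, appL C t => appL (C.rename ρ) (t.rename ρ)
  | ρ, appR t C => appR (t.rename ρ) (C.rename ρ)
  | ρ, pairL C t => pairL (C.rename ρ) (t.rename ρ)
  | ρ, pairR t C => pairR (t.rename ρ) (C.rename ρ)
  | ρ, lam C => lam (C.rename (liftRen ρ))
  | ρ, letL C t => letL (C.rename ρ) (t.rename (liftRen (liftRen ρ)))
  | ρ, letR t C => letR (t.rename ρ) (C.rename (liftRen (liftRen ρ)))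

end TmCtx

/-- The congruent closure of a relation: `C[r] ⟶ C[r']` whenever `R r r'`. -/
def CongClosure (R : Tm → Tm → Prop) (t t' : Tm) : Prop :=
  ∃ (C : TmCtx) (r r' : Tm), R r r' ∧ t = C.plug r ∧ t' = C.plug r'

/-- The rules `β₁`, `β₂`, `η₁`, `η₂` at the root of a term. -/
inductive RootStep : Tm → Tm → Prop
  | beta1 (t s : Tm) : RootStep (Tm.app (Tm.lam t) s) (t.inst1 s)
  | beta2 (u v w : Tm) : RootStep (Tm.letp (Tm.pair u v) w) (w.inst2 u v)
  | eta1 (t : Tm) : RootStep (Tm.lam (Tm.app (t.rename Nat.succ) (Tm.var 0))) t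
  | eta2 (t : Tm) : RootStep (Tm.letp t (Tm.pair (Tm.var 0) (Tm.var 1))) t

/-- One-step reduction `→_βη`. -/
def StepBetaEta : Tm → Tm → Prop := CongClosure RootStep

/-- In `C[let val (x, y) = t in u end]` with `k` variables captured by `C`, the term `u` sees
`x, y` at `0, 1`, then the captured variables at `2, …, k + 1`. In
`let val (x, y) = t in C[u] end` it sees the captured variables at `0, …, k - 1`, then `x, y` at
`k, k + 1`. Further variables keep their indices. -/
def exchangeRen (k i : ℕ) : ℕ :=
  if i < 2 then i + k else if i < k + 2 then i - 2 else i

/-- The commutative conversion `↔_c` between `C[let val (x, y) = t in u end]` and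
`let val (x, y) = t in C[u] end`. The condition that `C` captures no free variable of `t` is
expressed by shifting `t` over the captured variables, the condition that `x, y` are not free in
`C` by shifting `C` over `x, y`. -/
inductive CommConv : Tm → Tm → Prop
  | outward (C : TmCtx) (t u : Tm) :
      CommConv
        (C.plug (Tm.letp (t.rename (fun i => i + C.depth)) u))
        (Tm.letp t ((C.rename (fun i => i + 2)).plug (u.rename (exchangeRen C.depth))))
  | inward (C : TmCtx) (t u : Tm) :
      CommConv
        (Tm.letp t ((C.rename (fun i => i + 2)).plug (u.rename (exchangeRen C.depth))))
        (C.plug (Tm.letp (t.rename (fun i => i + C.depth)) u))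

/-- The congruent equivalence relation `=_c` generated by `↔_c`. -/
def EqC : Tm → Tm → Prop := Relation.EqvGen (CongClosure CommConv)

/-- The reduction `→_βηc`: a `→_βη` step modulo `=_c`. -/
def StepBetaEtaC (t u : Tm) : Prop :=
  ∃ t' u', EqC t t' ∧ StepBetaEta t' u' ∧ EqC u' u

/-- The typed equality `=_βηc`: `EqBetaEtaC Γ t s A` is `Γ ⊢ t = s : A`. -/
inductive EqBetaEtaC : Ctx → Tm → Tm → Ty → Prop
  | refl {Γ : Ctx} {t : Tm} {A : Ty} : HasType Γ t A → EqBetaEtaC Γ t t A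
  | symm {Γ : Ctx} {t s : Tm} {A : Ty} : EqBetaEtaC Γ t s A → EqBetaEtaC Γ s t A
  | trans {Γ : Ctx} {t s u : Tm} {A : Ty} :
      EqBetaEtaC Γ t s A → EqBetaEtaC Γ s u A → EqBetaEtaC Γ t u A
  | comm {Γ : Ctx} {t t' : Tm} {A : Ty} :
      HasType Γ t A → CommConv t t' → EqBetaEtaC Γ t t' A
  | step {Γ : Ctx} {t t' : Tm} {A : Ty} :
      HasType Γ t A → StepBetaEtaC t t' → EqBetaEtaC Γ t t' A
  | lam {Γ : Ctx} {t t' : Tm} {A B : Ty} :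
      EqBetaEtaC (Ctx.cons A Γ) t t' B →
      EqBetaEtaC Γ (Tm.lam t) (Tm.lam t') (Ty.lolli A B)
  | app {Γ Δ Ξ : Ctx} {t t' s s' : Tm} {A B : Ty} :
      Ctx.Merge Γ Δ Ξ → EqBetaEtaC Γ t t' (Ty.lolli A B) → EqBetaEtaC Δ s s' A →
      EqBetaEtaC Ξ (Tm.app t s) (Tm.app t' s') B
  | pair {Γ Δ Ξ : Ctx} {s s' t t' : Tm} {A B : Ty} :
      Ctx.Merge Γ Δ Ξ → EqBetaEtaC Γ s s' A → EqBetaEtaC Δ t t' B →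
      EqBetaEtaC Ξ (Tm.pair s t) (Tm.pair s' t') (Ty.tensor A B)
  | letp {Γ Δ Ξ : Ctx} {s s' t t' : Tm} {A B C : Ty} :
      Ctx.Merge Γ Δ Ξ → EqBetaEtaC Γ s s' (Ty.tensor A B) →
      EqBetaEtaC (Ctx.cons A (Ctx.cons B Δ)) t t' C →
      EqBetaEtaC Ξ (Tm.letp s t) (Tm.letp s' t') C

/-- `A` is a principal type of `t`. Principal types are unique up to renaming of
type variables. -/
def IsPrincipalType (t : Tm) (A : Ty) : Prop :=
  ∃ Γ : Ctx, HasType Γ t A ∧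
    ∀ (Γ' : Ctx) (A' : Ty), HasType Γ' t A' →
      ∃ θ : ℕ → Ty, A' = A.subst θ ∧ Γ' = Γ.subst θ

/-- `t` is poly-typable by `A -> B` with respect to `s`. The principal types of `t` and of `s`
are determined only up to renaming, and may be taken without common type variables. -/
def PolyTypable (t : Tm) (A B : Ty) (s : Tm) : Prop :=
  (∃ A' B', ClosedOf t (Ty.lolli A' B')) ∧ ClosedOf s A ∧
    ∃ (P Q A₀ : Ty) (θ : ℕ → Ty), IsPrincipalType t P ∧ IsPrincipalType s Q ∧
      P.subst θ = Ty.lolli A₀ B ∧ Q.subst θ = A₀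

/-- `t` is poly-typable by `A₁ -> ⋯ -> Aₙ -> B` with respect to `s₁, …, sₙ`. -/
def PolyTypableN (t : Tm) (As : List Ty) (B : Ty) (ss : List Tm) : Prop :=
  (∃ (As' : List Ty) (B' : Ty), As'.length = As.length ∧ ClosedOf t (Ty.arrows As' B')) ∧
    List.Forall₂ ClosedOf ss As ∧
    ∃ (P : Ty) (Qs As₀ : List Ty) (θ : ℕ → Ty), IsPrincipalType t P ∧
      List.Forall₂ IsPrincipalType ss Qs ∧
      P.subst θ = Ty.arrows As₀ B ∧ Qs.map (Ty.subst θ) = As₀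

end LinLam

namespace LinLam

/-! ### Substitution calculus -/

namespace Tm

-- A linear function cannot drop its argument, so a constant function has to consume it. Replace
-- every type variable of `A` by `B ⊸ B`, giving `A.endo B`; closed terms of `A` are also closed
-- terms of this instance. By recursion on `A` there are a closed eraser `A.endo B ⊸ (B ⊸ B)` and a
-- closed filler in the opposite direction. The eraser of an implication feeds the function a filler
-- and erases the result; the filler of an implication erases its argument and fills the result. The
-- constant function is `λx. (eraser x) u`.
--
-- That the eraser sends a closed term `s` to the identity is shown with a logical relation `Red`
-- whose base relation is equality to the identity. Closed terms are related to themselves by the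
-- fundamental lemma `HasType.red`, and `eraser_filler_spec` shows that erasers send related terms
-- to the identity and fillers send the identity to related terms. Only the two β rules and
-- congruence are used. Several arguments are handled by iteration.
--
-- Poly-typability needs no computation of principal types. They exist, as least general
-- generalizations of all types of a closed term (`HasType.lgg`), and once renamed apart they are
-- jointly instantiated to any given typings (`exists_principalTypes_subst`).

theorem rename_eq_subst (t : Tm) : ∀ ρ : ℕ → ℕ, t.rename ρ = t.subst fun i => var (ρ i) := by
  have key : ∀ ρ : ℕ → ℕ, (fun i => var (liftRen ρ i)) = liftSub fun i => var (ρ i) := by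
    intro ρ
    funext i
    cases i <;> rfl
  induction t with
  | var i => intro ρ; rfl
  | app t s iht ihs => intro ρ; simp only [rename, subst, iht, ihs]
  | pair s t ihs iht => intro ρ; simp only [rename, subst, iht, ihs]
  | lam t ih => intro ρ; simp only [rename, subst, ih, key]
  | letp s t ihs iht => intro ρ; simp only [rename, subst, iht, ihs, key]

theorem subst_rename (t : Tm) : ∀ (ρ : ℕ → ℕ) (σ : ℕ → Tm),
    (t.rename ρ).subst σ = t.subst fun i => σ (ρ i) := by
  have key : ∀ (ρ : ℕ → ℕ) (σ : ℕ → Tm),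
      (fun i => liftSub σ (liftRen ρ i)) = liftSub fun i => σ (ρ i) := by
    intro ρ σ
    funext i
    cases i <;> rfl
  induction t with
  | var i => intro ρ σ; rfl
  | app t s iht ihs => intro ρ σ; simp only [rename, subst, iht, ihs]
  | pair s t ihs iht => intro ρ σ; simp only [rename, subst, iht, ihs]
  | lam t ih => intro ρ σ; simp only [rename, subst, ih, key]
  | letp s t ihs iht => intro ρ σ; simp only [rename, subst, iht, ihs, key]

theorem rename_rename (t : Tm) (ρ ρ' : ℕ → ℕ) :
    (t.rename ρ).rename ρ' = t.rename fun i => ρ' (ρ i) := by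
  rw [rename_eq_subst _ ρ', subst_rename, rename_eq_subst]

theorem rename_subst (t : Tm) : ∀ (σ : ℕ → Tm) (ρ : ℕ → ℕ),
    (t.subst σ).rename ρ = t.subst fun i => (σ i).rename ρ := by
  have key : ∀ (σ : ℕ → Tm) (ρ : ℕ → ℕ),
      (fun i => (liftSub σ i).rename (liftRen ρ)) = liftSub fun i => (σ i).rename ρ := by
    intro σ ρ
    funext i
    cases i with
    | zero => rfl
    | succ i => simp only [liftSub, rename_rename]; rfl
  induction t with
  | var i => intro σ ρ; rfl
  | app t s iht ihs => intro σ ρ; simp only [rename, subst, iht, ihs]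
  | pair s t ihs iht => intro σ ρ; simp only [rename, subst, iht, ihs]
  | lam t ih => intro σ ρ; simp only [rename, subst, ih, key]
  | letp s t ihs iht => intro σ ρ; simp only [rename, subst, iht, ihs, key]

theorem subst_subst (t : Tm) : ∀ σ τ : ℕ → Tm,
    (t.subst σ).subst τ = t.subst fun i => (σ i).subst τ := by
  have key : ∀ σ τ : ℕ → Tm,
      (fun i => (liftSub σ i).subst (liftSub τ)) = liftSub fun i => (σ i).subst τ := by
    intro σ τ
    funext i
    cases i with
    | zero => rfl
    | succ i => simp only [liftSub, rename_subst, subst_rename]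
  induction t with
  | var i => intro σ τ; rfl
  | app t s iht ihs => intro σ τ; simp only [subst, iht, ihs]
  | pair s t ihs iht => intro σ τ; simp only [subst, iht, ihs]
  | lam t ih => intro σ τ; simp only [subst, ih, key]
  | letp s t ihs iht => intro σ τ; simp only [subst, iht, ihs, key]

theorem subst_var (t : Tm) : t.subst var = t := by
  have key : liftSub var = var := by
    funext i
    cases i <;> rfl
  induction t with
  | var i => rfl
  | app t s iht ihs => simp only [subst, iht, ihs]
  | pair s t ihs iht => simp only [subst, iht, ihs]
  | lam t ih => simp only [subst, ih, key]
  | letp s t ihs iht => simp only [subst, iht, ihs, key]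

/-- Extension of a substitution by a value for the index `0`. -/
def scons (u : Tm) (σ : ℕ → Tm) : ℕ → Tm
  | 0 => u
  | i + 1 => σ i

theorem inst1_subst_liftSub (t u : Tm) (σ : ℕ → Tm) :
    (t.subst (liftSub σ)).inst1 u = t.subst (scons u σ) := by
  rw [inst1, subst_subst]
  congr 1
  funext i
  cases i with
  | zero => rfl
  | succ i => simp only [liftSub, subst_rename, scons]; exact subst_var _

theorem inst2_subst_liftSub (t u v : Tm) (σ : ℕ → Tm) :
    (t.subst (liftSub (liftSub σ))).inst2 u v = t.subst (scons u (scons v σ)) := by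
  rw [inst2, subst_subst]
  congr 1
  funext i
  match i with
  | 0 => rfl
  | 1 => rfl
  | i + 2 => simp only [liftSub, subst_rename, scons]; exact subst_var _

end Tm

/-! ### Typing contexts -/

namespace Ctx

theorem merge_empty_left (Γ : Ctx) : Merge empty Γ Γ := fun _ => Or.inl ⟨rfl, rfl⟩

theorem merge_empty_right (Γ : Ctx) : Merge Γ empty Γ := fun _ => Or.inr ⟨rfl, rfl⟩

theorem Merge.eq_none_iff {Γ Δ Ξ : Ctx} (h : Merge Γ Δ Ξ) (i : ℕ) :
    Ξ i = none ↔ Γ i = none ∧ Δ i = none := by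
  rcases h i with ⟨h1, h2⟩ | ⟨h1, h2⟩ <;> simp [h1, h2]

theorem Merge.left {Γ Δ Ξ : Ctx} (h : Merge Γ Δ Ξ) {i : ℕ} {A : Ty} (hi : Γ i = some A) :
    Ξ i = some A := by
  rcases h i with ⟨h1, h2⟩ | ⟨h1, h2⟩ <;> simp_all

theorem Merge.right {Γ Δ Ξ : Ctx} (h : Merge Γ Δ Ξ) {i : ℕ} {A : Ty} (hi : Δ i = some A) :
    Ξ i = some A := by
  rcases h i with ⟨h1, h2⟩ | ⟨h1, h2⟩ <;> simp_all

theorem Merge.subst {Γ Δ Ξ : Ctx} (h : Merge Γ Δ Ξ) (θ : ℕ → Ty) :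
    Merge (Γ.subst θ) (Δ.subst θ) (Ξ.subst θ) := by
  intro i
  rcases h i with ⟨h1, h2⟩ | ⟨h1, h2⟩ <;> simp [Ctx.subst, h1, h2]

theorem subst_cons (θ : ℕ → Ty) (A : Ty) (Γ : Ctx) :
    (cons A Γ).subst θ = cons (A.subst θ) (Γ.subst θ) := by
  funext i
  cases i <;> rfl

theorem subst_single (θ : ℕ → Ty) (i : ℕ) (A : Ty) :
    (single i A).subst θ = single i (A.subst θ) := by
  funext j
  by_cases h : j = i <;> simp [Ctx.subst, single, h]

theorem cons_empty (A : Ty) : cons A empty = single 0 A := by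
  funext i
  cases i <;> simp [cons, empty, single]

/-- The part of a context that declares variables below `n`. -/
def restrict (n : ℕ) (Γ : Ctx) : Ctx := fun i => if i < n then Γ i else none

theorem restrict_zero (Γ : Ctx) : restrict 0 Γ = empty := by
  funext i
  simp [restrict, empty]

theorem restrict_cons (n : ℕ) (A : Ty) (Γ : Ctx) :
    restrict (n + 1) (cons A Γ) = cons A (restrict n Γ) := by
  funext i
  cases i <;> simp [restrict, cons]

theorem Merge.restrict {Γ Δ Ξ : Ctx} (h : Merge Γ Δ Ξ) (n : ℕ) :
    Merge (Γ.restrict n) (Δ.restrict n) (Ξ.restrict n) := by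
  intro i
  by_cases hi : i < n
  · simpa [Ctx.restrict, hi] using h i
  · simp [Ctx.restrict, hi]

end Ctx

/-! ### Typing and substitution -/

theorem HasType.substTy {Γ : Ctx} {t : Tm} {A : Ty} (h : HasType Γ t A) (θ : ℕ → Ty) :
    HasType (Γ.subst θ) t (A.subst θ) := by
  induction h with
  | var i A => rw [Ctx.subst_single]; exact .var i _
  | lam _ ih => rw [Ctx.subst_cons] at ih; exact .lam ih
  | app hm _ _ ih1 ih2 => exact .app (hm.subst θ) ih1 ih2
  | pair hm _ _ ih1 ih2 => exact .pair (hm.subst θ) ih1 ih2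
  | letp hm _ _ ih1 ih2 =>
    rw [Ctx.subst_cons, Ctx.subst_cons] at ih2
    exact .letp (hm.subst θ) ih1 ih2

theorem ClosedOf.substTy {t : Tm} {A : Ty} (h : ClosedOf t A) (θ : ℕ → Ty) :
    ClosedOf t (A.subst θ) :=
  HasType.substTy h θ

theorem HasType.var_inv {Γ : Ctx} {i : ℕ} {A : Ty} (h : HasType Γ (Tm.var i) A) :
    Γ = Ctx.single i A := by
  cases h
  rfl

theorem HasType.app_inv {Ξ : Ctx} {t s : Tm} {B : Ty} (h : HasType Ξ (Tm.app t s) B) :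
    ∃ Γ Δ A, Ctx.Merge Γ Δ Ξ ∧ HasType Γ t (Ty.lolli A B) ∧ HasType Δ s A := by
  cases h with | app hm h1 h2 => exact ⟨_, _, _, hm, h1, h2⟩

theorem HasType.lam_inv {Γ : Ctx} {t : Tm} {C : Ty} (h : HasType Γ (Tm.lam t) C) :
    ∃ A B, C = Ty.lolli A B ∧ HasType (Ctx.cons A Γ) t B := by
  cases h with | lam h1 => exact ⟨_, _, rfl, h1⟩

theorem HasType.pair_inv {Ξ : Ctx} {s t : Tm} {C : Ty} (h : HasType Ξ (Tm.pair s t) C) :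
    ∃ Γ Δ A B, C = Ty.tensor A B ∧ Ctx.Merge Γ Δ Ξ ∧ HasType Γ s A ∧ HasType Δ t B := by
  cases h with | pair hm h1 h2 => exact ⟨_, _, _, _, rfl, hm, h1, h2⟩

theorem HasType.letp_inv {Ξ : Ctx} {s t : Tm} {C : Ty} (h : HasType Ξ (Tm.letp s t) C) :
    ∃ Γ Δ A B, Ctx.Merge Γ Δ Ξ ∧ HasType Γ s (Ty.tensor A B) ∧
      HasType (Ctx.cons A (Ctx.cons B Δ)) t C := by
  cases h with | letp hm h1 h2 => exact ⟨_, _, _, _, hm, h1, h2⟩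

/-- The variables declared by a context are the free variables of the term. -/
theorem HasType.eq_none_iff {Γ Γ' : Ctx} {t : Tm} {A A' : Ty} (h : HasType Γ t A)
    (h' : HasType Γ' t A') (i : ℕ) : Γ i = none ↔ Γ' i = none := by
  induction h generalizing Γ' A' i with
  | var j A => cases h'; by_cases hi : i = j <;> simp [Ctx.single, hi]
  | lam _ ih => cases h' with | lam h' => exact ih h' (i + 1)
  | app hm _ _ ih1 ih2 =>
    cases h' with | app hm' h1 h2 => rw [hm.eq_none_iff, hm'.eq_none_iff, ih1 h1, ih2 h2]
  | pair hm _ _ ih1 ih2 =>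
    cases h' with | pair hm' h1 h2 => rw [hm.eq_none_iff, hm'.eq_none_iff, ih1 h1, ih2 h2]
  | letp hm _ _ ih1 ih2 =>
    cases h' with
    | letp hm' h1 h2 =>
      rw [hm.eq_none_iff, hm'.eq_none_iff, ih1 h1]
      exact and_congr_right fun _ => ih2 h2 (i + 2)

theorem HasType.ctx_eq_empty {Γ : Ctx} {t : Tm} {A A' : Ty} (h : HasType Γ t A)
    (h' : ClosedOf t A') : Γ = Ctx.empty :=
  funext fun i => (h.eq_none_iff h' i).2 rfl

theorem HasType.subst_eq_self {Γ : Ctx} {t : Tm} {A : Ty} (h : HasType Γ t A) :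
    ∀ σ : ℕ → Tm, (∀ i B, Γ i = some B → σ i = Tm.var i) → t.subst σ = t := by
  have key : ∀ (σ : ℕ → Tm) (A : Ty) (Γ : Ctx), (∀ i B, Γ i = some B → σ i = Tm.var i) →
      ∀ i B, Ctx.cons A Γ i = some B → Tm.liftSub σ i = Tm.var i := by
    intro σ A Γ hσ i B hi
    cases i with
    | zero => rfl
    | succ i => simp only [Tm.liftSub, hσ i B hi]; rfl
  induction h with
  | var i A => intro σ hσ; exact hσ i A (by simp [Ctx.single])
  | lam _ ih => intro σ hσ; rw [Tm.subst, ih _ (key _ _ _ hσ)]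
  | app hm _ _ ih1 ih2 =>
    intro σ hσ
    rw [Tm.subst, ih1 _ fun i B hi => hσ i B (hm.left hi),
      ih2 _ fun i B hi => hσ i B (hm.right hi)]
  | pair hm _ _ ih1 ih2 =>
    intro σ hσ
    rw [Tm.subst, ih1 _ fun i B hi => hσ i B (hm.left hi),
      ih2 _ fun i B hi => hσ i B (hm.right hi)]
  | letp hm _ _ ih1 ih2 =>
    intro σ hσ
    rw [Tm.subst, ih1 _ fun i B hi => hσ i B (hm.left hi),
      ih2 _ (key _ _ _ (key _ _ _ fun i B hi => hσ i B (hm.right hi)))]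

theorem ClosedOf.subst_eq {t : Tm} {A : Ty} (h : ClosedOf t A) (σ : ℕ → Tm) : t.subst σ = t :=
  HasType.subst_eq_self h σ fun _ _ hi => nomatch hi

theorem ClosedOf.rename_eq {t : Tm} {A : Ty} (h : ClosedOf t A) (ρ : ℕ → ℕ) :
    t.rename ρ = t := by
  rw [Tm.rename_eq_subst, h.subst_eq]

theorem Tm.liftSub_eq_var {n : ℕ} {σ : ℕ → Tm} (hσ : ∀ i < n, σ i = Tm.var i) :
    ∀ i < n + 1, Tm.liftSub σ i = Tm.var i := by
  intro i hi
  cases i with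
  | zero => rfl
  | succ i => simp only [Tm.liftSub, hσ i (by omega)]; rfl

theorem closedOf_liftSub {n : ℕ} {σ : ℕ → Tm} {Γ : Ctx}
    (hσ : ∀ i B, n ≤ i → Γ i = some B → ClosedOf (σ i) B) (A : Ty) :
    ∀ i B, n + 1 ≤ i → Ctx.cons A Γ i = some B → ClosedOf (Tm.liftSub σ i) B := by
  intro i B hn hi
  cases i with
  | zero => omega
  | succ i =>
    have := hσ i B (by omega) hi
    simpa only [Tm.liftSub, this.rename_eq] using this

/-- Closed terms may be substituted for the variables from `n` on. -/
theorem HasType.subst_restrict {Γ : Ctx} {t : Tm} {A : Ty} (h : HasType Γ t A) :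
    ∀ (n : ℕ) (σ : ℕ → Tm), (∀ i < n, σ i = Tm.var i) →
      (∀ i B, n ≤ i → Γ i = some B → ClosedOf (σ i) B) →
      HasType (Γ.restrict n) (t.subst σ) A := by
  induction h with
  | var i A =>
    intro n σ h1 h2
    by_cases hi : i < n
    · have : (Ctx.single i A).restrict n = Ctx.single i A := by
        funext j
        by_cases hj : j = i <;> simp [Ctx.restrict, Ctx.single, hj, hi]
      rw [this, Tm.subst, h1 i hi]
      exact .var i A
    · have : (Ctx.single i A).restrict n = Ctx.empty := by
        funext j
        by_cases hj : j = i <;> simp [Ctx.restrict, Ctx.single, Ctx.empty, hj, hi]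
      rw [this, Tm.subst]
      exact h2 i A (by omega) (by simp [Ctx.single])
  | lam _ ih =>
    intro n σ h1 h2
    have := ih (n + 1) _ (Tm.liftSub_eq_var h1) (closedOf_liftSub h2 _)
    rw [Ctx.restrict_cons] at this
    exact .lam this
  | app hm _ _ ih1 ih2 =>
    intro n σ h1 h2
    exact .app (hm.restrict n) (ih1 n σ h1 fun i B hn hi => h2 i B hn (hm.left hi))
      (ih2 n σ h1 fun i B hn hi => h2 i B hn (hm.right hi))
  | pair hm _ _ ih1 ih2 =>
    intro n σ h1 h2
    exact .pair (hm.restrict n) (ih1 n σ h1 fun i B hn hi => h2 i B hn (hm.left hi))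
      (ih2 n σ h1 fun i B hn hi => h2 i B hn (hm.right hi))
  | letp hm _ _ ih1 ih2 =>
    intro n σ h1 h2
    have := ih2 (n + 2) _ (Tm.liftSub_eq_var (Tm.liftSub_eq_var h1))
      (closedOf_liftSub (closedOf_liftSub (fun i B hn hi => h2 i B hn (hm.right hi)) _) _)
    rw [Ctx.restrict_cons, Ctx.restrict_cons] at this
    exact .letp (hm.restrict n) (ih1 n σ h1 fun i B hn hi => h2 i B hn (hm.left hi)) this

theorem HasType.subst_closed {Γ : Ctx} {t : Tm} {A : Ty} (h : HasType Γ t A) (σ : ℕ → Tm)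
    (hσ : ∀ i B, Γ i = some B → ClosedOf (σ i) B) : ClosedOf (t.subst σ) A := by
  have := h.subst_restrict 0 σ (by simp) fun i B _ => hσ i B
  rwa [Ctx.restrict_zero] at this

theorem HasType.subst_closed_two {Γ : Ctx} {t : Tm} {A B C : Ty}
    (h : HasType (Ctx.cons A (Ctx.cons B Γ)) t C) (σ : ℕ → Tm)
    (hσ : ∀ i X, Γ i = some X → ClosedOf (σ i) X) :
    HasType (Ctx.cons A (Ctx.cons B Ctx.empty)) (t.subst (Tm.liftSub (Tm.liftSub σ))) C := by
  have := h.subst_restrict 2 _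
    (Tm.liftSub_eq_var (Tm.liftSub_eq_var (n := 0) (σ := σ) (by simp)))
    (closedOf_liftSub (closedOf_liftSub (n := 0) (fun i X _ => hσ i X) _) _)
  rwa [Ctx.restrict_cons, Ctx.restrict_cons, Ctx.restrict_zero] at this

/-! ### Principal types of closed terms -/

namespace Ty

/-- The first component of a compound type. -/
def left : Ty → Ty
  | var a => var a
  | tensor A _ => A
  | lolli A _ => A

/-- The second component of a compound type. -/
def right : Ty → Ty
  | var a => var a
  | tensor _ B => B
  | lolli _ B => B

open Classical in
/-- The least general generalization of the family `f`, computed along a shape; `code` names the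
variables that stand for the subfamilies without a common outermost connective. -/
noncomputable def lgg {S : Type} (code : (S → Ty) → ℕ) : Ty → (S → Ty) → Ty
  | var _, f => var (code f)
  | tensor X Y, f =>
    if ∀ s, f s = tensor (f s).left (f s).right then
      tensor (lgg code X fun s => (f s).left) (lgg code Y fun s => (f s).right)
    else var (code f)
  | lolli X Y, f =>
    if ∀ s, f s = lolli (f s).left (f s).right then
      lolli (lgg code X fun s => (f s).left) (lgg code Y fun s => (f s).right)
    else var (code f)

/-- A family that consists uniformly of tensors is generalized componentwise. This, with its
analogue for implications, is the only property of `Ty.lgg` that the typing rules require. -/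
theorem lgg_tensor {S : Type} (code : (S → Ty) → ℕ) (s₀ : S) (A B : S → Ty) :
    lgg code (tensor (A s₀) (B s₀)) (fun s => tensor (A s) (B s)) =
      tensor (lgg code (A s₀) A) (lgg code (B s₀) B) :=
  if_pos fun _ => rfl

theorem lgg_lolli {S : Type} (code : (S → Ty) → ℕ) (s₀ : S) (A B : S → Ty) :
    lgg code (lolli (A s₀) (B s₀)) (fun s => lolli (A s) (B s)) =
      lolli (lgg code (A s₀) A) (lgg code (B s₀) B) :=
  if_pos fun _ => rfl

/-- Every member of a family is an instance of its generalization. -/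
theorem exists_finite_lgg_subst {S : Type} (X : Ty) : ∀ f : S → Ty, ∃ F : Set (S → Ty),
    F.Finite ∧ ∀ (code : (S → Ty) → ℕ) (θ : ℕ → Ty) (s : S),
      (∀ g ∈ F, θ (code g) = g s) → (lgg code X f).subst θ = f s := by
  induction X with
  -- `F` collects the subfamilies that become variables. It is fixed before `code`, so that `code`
  -- need only be injective on a finite set.
  | var a => exact fun f => ⟨{f}, Set.finite_singleton f, fun code θ s h => h f rfl⟩
  | tensor X Y ihX ihY =>
    intro f
    by_cases hf : ∀ s, f s = tensor (f s).left (f s).right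
    · obtain ⟨F, hF, h1⟩ := ihX fun s => (f s).left
      obtain ⟨F', hF', h2⟩ := ihY fun s => (f s).right
      refine ⟨F ∪ F', hF.union hF', fun code θ s h => ?_⟩
      rw [lgg, if_pos hf, subst, h1 code θ s fun g hg => h g (Or.inl hg),
        h2 code θ s fun g hg => h g (Or.inr hg), ← hf s]
    · refine ⟨{f}, Set.finite_singleton f, fun code θ s h => ?_⟩
      rw [lgg, if_neg hf]
      exact h f rfl
  | lolli X Y ihX ihY =>
    intro f
    by_cases hf : ∀ s, f s = lolli (f s).left (f s).right
    · obtain ⟨F, hF, h1⟩ := ihX fun s => (f s).left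
      obtain ⟨F', hF', h2⟩ := ihY fun s => (f s).right
      refine ⟨F ∪ F', hF.union hF', fun code θ s h => ?_⟩
      rw [lgg, if_pos hf, subst, h1 code θ s fun g hg => h g (Or.inl hg),
        h2 code θ s fun g hg => h g (Or.inr hg), ← hf s]
    · refine ⟨{f}, Set.finite_singleton f, fun code θ s h => ?_⟩
      rw [lgg, if_neg hf]
      exact h f rfl

theorem subst_subst (A : Ty) (θ θ' : ℕ → Ty) :
    (A.subst θ).subst θ' = A.subst fun a => (θ a).subst θ' := by
  induction A with
  | var a => rfl
  | tensor A B ihA ihB => simp only [subst, ihA, ihB]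
  | lolli A B ihA ihB => simp only [subst, ihA, ihB]

end Ty

/-- Pointwise generalization of a family of contexts with the same domain. -/
noncomputable def Ctx.lgg {S : Type} (code : (S → Ty) → ℕ) (s₀ : S) (Γ : S → Ctx) : Ctx :=
  -- The default `A` is never reached when all the contexts have the same domain.
  fun i => (Γ s₀ i).map fun A => Ty.lgg code A fun s => (Γ s i).getD A

theorem Ctx.lgg_cons {S : Type} (code : (S → Ty) → ℕ) (s₀ : S) (A : S → Ty) (Γ : S → Ctx) :
    Ctx.lgg code s₀ (fun s => Ctx.cons (A s) (Γ s)) =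
      Ctx.cons (Ty.lgg code (A s₀) A) (Ctx.lgg code s₀ Γ) := by
  funext i
  cases i <;> rfl

/-- The side to which a variable belongs is read off at `s₀`; agreement of the domains makes the
same side valid for every `s`. -/
theorem Ctx.Merge.lgg {S : Type} (code : (S → Ty) → ℕ) (s₀ : S) {Γ Δ Ξ : S → Ctx}
    (h : ∀ s, Ctx.Merge (Γ s) (Δ s) (Ξ s)) (hΓ : ∀ s i, Γ s i = none ↔ Γ s₀ i = none)
    (hΔ : ∀ s i, Δ s i = none ↔ Δ s₀ i = none) :
    Ctx.Merge (Ctx.lgg code s₀ Γ) (Ctx.lgg code s₀ Δ) (Ctx.lgg code s₀ Ξ) := by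
  intro i
  rcases h s₀ i with ⟨h1, h2⟩ | ⟨h1, h2⟩
  · left
    have : ∀ s, Ξ s i = Δ s i := by
      intro s
      have h3 := (hΓ s i).2 h1
      rcases h s i with ⟨_, h4⟩ | ⟨h4, h5⟩
      · exact h4
      · rw [h5, h3, h4]
    simp [Ctx.lgg, h1, this]
  · right
    have : ∀ s, Ξ s i = Γ s i := by
      intro s
      have h3 := (hΔ s i).2 h1
      rcases h s i with ⟨h4, h5⟩ | ⟨_, h4⟩
      · rw [h5, h3, h4]
      · exact h4
    simp [Ctx.lgg, h1, this]

/-- Typings of a term are closed under generalization. -/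
theorem HasType.lgg {S : Type} (code : (S → Ty) → ℕ) (s₀ : S) (t : Tm) :
    ∀ (Γ : S → Ctx) (A : S → Ty), (∀ s, HasType (Γ s) t (A s)) →
      HasType (Ctx.lgg code s₀ Γ) t (Ty.lgg code (A s₀) A) := by
  have dom : ∀ {Γ : S → Ctx} {t : Tm} {A : S → Ty}, (∀ s, HasType (Γ s) t (A s)) →
      ∀ s i, Γ s i = none ↔ Γ s₀ i = none := fun h s i => (h s).eq_none_iff (h s₀) i
  induction t with
  | var j =>
    intro Γ A h
    have hΓ : Γ = fun s => Ctx.single j (A s) := funext fun s => (h s).var_inv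
    have : Ctx.lgg code s₀ Γ = Ctx.single j (Ty.lgg code (A s₀) A) := by
      funext i
      by_cases hi : i = j <;> simp [Ctx.lgg, hΓ, Ctx.single, hi]
    rw [this]
    exact .var _ _
  | app t s iht ihs =>
    intro Γ A h
    -- The argument type varies with the derivation. Generalizing it as a family, with the same
    -- `code` in both premises, makes the two premises match.
    choose Γ₁ Γ₂ B hm h1 h2 using fun s' => (h s').app_inv
    have h3 := iht _ _ h1
    rw [Ty.lgg_lolli code s₀ B A] at h3
    exact .app (Ctx.Merge.lgg code s₀ hm (dom h1) (dom h2)) h3 (ihs _ _ h2)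
  | lam t ih =>
    intro Γ A h
    choose X Y hA h1 using fun s => (h s).lam_inv
    have h2 := ih _ _ h1
    rw [Ctx.lgg_cons] at h2
    rw [funext hA, Ty.lgg_lolli code s₀ X Y]
    exact .lam h2
  | pair s t ihs iht =>
    intro Γ A h
    choose Γ₁ Γ₂ X Y hA hm h1 h2 using fun s' => (h s').pair_inv
    rw [funext hA, Ty.lgg_tensor code s₀ X Y]
    exact .pair (Ctx.Merge.lgg code s₀ hm (dom h1) (dom h2)) (ihs _ _ h1) (iht _ _ h2)
  | letp s t ihs iht =>
    intro Γ A h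
    choose Γ₁ Γ₂ X Y hm h1 h2 using fun s' => (h s').letp_inv
    have h3 := ihs _ _ h1
    rw [Ty.lgg_tensor code s₀ X Y] at h3
    have h4 := iht _ _ h2
    rw [Ctx.lgg_cons, Ctx.lgg_cons] at h4
    exact .letp (Ctx.Merge.lgg code s₀ hm (dom h1) fun s i => dom h2 s (i + 2)) h3 h4

/-- Unification is avoided: the principal type is the generalization of the family of all types of
`t`, indexed by those types themselves. -/
theorem ClosedOf.exists_isPrincipalType {t : Tm} {A : Ty} (h : ClosedOf t A) :
    ∃ P, IsPrincipalType t P := by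
  let S := {A : Ty // ClosedOf t A}
  let f : S → Ty := Subtype.val
  obtain ⟨F, hF, hsub⟩ := Ty.exists_finite_lgg_subst A f
  -- `S → Ty` may be uncountable, but only the finitely many subfamilies in `F` need distinct names.
  obtain ⟨code, hcode⟩ := Set.countable_iff_exists_injOn.1 hF.countable
  refine ⟨Ty.lgg code A f, Ctx.empty,
    HasType.lgg code ⟨A, h⟩ t (fun _ => Ctx.empty) f Subtype.property, fun Γ' A' h' => ?_⟩
  obtain rfl := h'.ctx_eq_empty h
  have : Nonempty (S → Ty) := ⟨f⟩
  -- The substitution decodes a variable to its subfamily and evaluates that at `A'`.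
  refine ⟨fun a => Function.invFunOn code F a ⟨A', h'⟩, ?_, rfl⟩
  refine (hsub code _ ⟨A', h'⟩ fun g hg => ?_).symm
  exact congrFun (hcode.leftInvOn_invFunOn hg) _

theorem IsPrincipalType.rename {t : Tm} {P : Ty} (h : IsPrincipalType t P) {ρ ρ' : ℕ → ℕ}
    (hρ : ∀ a, ρ' (ρ a) = a) : IsPrincipalType t (P.subst fun a => Ty.var (ρ a)) := by
  obtain ⟨Γ, h1, h2⟩ := h
  refine ⟨_, h1.substTy _, fun Γ' A' h' => ?_⟩
  obtain ⟨θ, rfl, rfl⟩ := h2 Γ' A' h'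
  refine ⟨fun a => θ (ρ' a), ?_, ?_⟩
  · simp [Ty.subst_subst, Ty.subst, hρ]
  · funext i
    cases hi : Γ i <;> simp [Ctx.subst, hi, Ty.subst_subst, Ty.subst, hρ]

/-- Closed terms have principal types without common type variables, so that one type
substitution yields given types of all of them. -/
theorem exists_principalTypes_subst {ts : List Tm} {As : List Ty}
    (h : List.Forall₂ ClosedOf ts As) :
    ∃ (Ps : List Ty) (θ : ℕ → Ty), List.Forall₂ IsPrincipalType ts Ps ∧
      Ps.map (Ty.subst θ) = As := by
  induction h with
  | nil => exact ⟨[], Ty.var, .nil, rfl⟩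
  | @cons t A ts As h _ ih =>
    obtain ⟨Ps, θ, h1, h2⟩ := ih
    obtain ⟨P, hP⟩ := h.exists_isPrincipalType
    obtain ⟨Γ, hΓ, hmax⟩ := id hP
    obtain ⟨θ', hA, -⟩ := hmax _ _ h
    -- Even variables go to the first term and odd ones to the others, so the two substitutions can
    -- be interleaved.
    refine ⟨(P.subst fun a => Ty.var (2 * a)) ::
        Ps.map (Ty.subst fun a => Ty.var (2 * a + 1)),
      fun a => if a % 2 = 0 then θ' (a / 2) else θ (a / 2), .cons ?_ ?_, ?_⟩
    · exact hP.rename (ρ' := fun a => a / 2) fun a => by omega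
    · rw [List.forall₂_map_right_iff]
      exact h1.imp fun _ _ hQ => hQ.rename (ρ' := fun a => a / 2) fun a => by omega
    · have h3 : ∀ a, (2 * a + 1) / 2 = a := fun a => by omega
      simp [Ty.subst_subst, Ty.subst, Nat.add_mod, hA, ← h2, h3]

/-! ### Typed equality -/

theorem EqBetaEtaC.of_rootStep {Γ : Ctx} {t t' : Tm} {A : Ty} (h : HasType Γ t A)
    (hr : RootStep t t') : EqBetaEtaC Γ t t' A :=
  .step h ⟨t, t', .refl _, ⟨.hole, t, t', hr, rfl, rfl⟩, .refl _⟩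

theorem ClosedOf.app {t s : Tm} {A B : Ty} (ht : ClosedOf t (Ty.lolli A B))
    (hs : ClosedOf s A) : ClosedOf (Tm.app t s) B :=
  HasType.app (Ctx.merge_empty_left _) ht hs

theorem EqBetaEtaC.appClosed {t t' s s' : Tm} {A B : Ty}
    (ht : EqBetaEtaC Ctx.empty t t' (Ty.lolli A B)) (hs : EqBetaEtaC Ctx.empty s s' A) :
    EqBetaEtaC Ctx.empty (Tm.app t s) (Tm.app t' s') B :=
  .app (Ctx.merge_empty_left _) ht hs

theorem EqBetaEtaC.beta {Γ : Ctx} {t s r : Tm} {A : Ty}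
    (h : HasType Γ (Tm.app (Tm.lam t) s) A) (hr : t.inst1 s = r) :
    EqBetaEtaC Γ (Tm.app (Tm.lam t) s) r A :=
  hr ▸ .of_rootStep h (.beta1 t s)

/-- The identity `λx. x`. -/
def Tm.idTm : Tm := Tm.lam (Tm.var 0)

/-- The composition `λz. t (s z)` of closed terms. -/
def Tm.comp (t s : Tm) : Tm := Tm.lam (Tm.app t (Tm.app s (Tm.var 0)))

open Tm (idTm comp)

theorem closedOf_idTm (A : Ty) : ClosedOf idTm (Ty.lolli A A) := by
  refine .lam ?_
  rw [Ctx.cons_empty]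
  exact .var 0 A

/-- `comp` does not shift its arguments, so for open `t` and `s` the indices are those seen under
its binder. The condition `h0` rules out capture, and the resulting context is shifted down by one.
-/
theorem hasType_comp {Γ Δ Ξ : Ctx} {t s : Tm} {A B C : Ty} (hm : Ctx.Merge Γ Δ Ξ)
    (h0 : Ξ 0 = none) (ht : HasType Γ t (Ty.lolli B C)) (hs : HasType Δ s (Ty.lolli A B)) :
    HasType (fun i => Ξ (i + 1)) (comp t s) (Ty.lolli A C) := by
  refine .lam (.app (Γ := Γ) (Δ := Ctx.cons A fun i => Δ (i + 1)) ?_ ht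
    (.app (Γ := Δ) (Δ := Ctx.single 0 A) ?_ hs (.var 0 A)))
  · intro i
    cases i with
    | zero => exact Or.inl ⟨((hm.eq_none_iff 0).1 h0).1, rfl⟩
    | succ i => exact hm (i + 1)
  · intro i
    cases i with
    | zero => exact Or.inl ⟨((hm.eq_none_iff 0).1 h0).2, rfl⟩
    | succ i => exact Or.inr ⟨rfl, rfl⟩

theorem ClosedOf.comp {t s : Tm} {A B C : Ty} (ht : ClosedOf t (Ty.lolli B C))
    (hs : ClosedOf s (Ty.lolli A B)) : ClosedOf (comp t s) (Ty.lolli A C) :=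
  hasType_comp (Ctx.merge_empty_left _) rfl ht hs

theorem EqBetaEtaC.comp_idTm {t s : Tm} {A : Ty}
    (ht : EqBetaEtaC Ctx.empty t idTm (Ty.lolli A A))
    (hs : EqBetaEtaC Ctx.empty s idTm (Ty.lolli A A)) :
    EqBetaEtaC Ctx.empty (comp t s) idTm (Ty.lolli A A) := by
  have hv : HasType (Ctx.single 0 A) (Tm.var 0) A := .var 0 A
  have hid : HasType (Ctx.single 0 A) (Tm.app idTm (Tm.var 0)) A :=
    .app (Ctx.merge_empty_left _) (closedOf_idTm A) hv
  refine .lam ?_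
  rw [Ctx.cons_empty]
  have h1 := EqBetaEtaC.app (Ctx.merge_empty_left _) hs (.refl hv)
  have h2 := EqBetaEtaC.beta hid rfl
  exact (EqBetaEtaC.app (Ctx.merge_empty_left _) ht (h1.trans h2)).trans h2

/-! ### Erasing terms -/

/-- The instance of a type with all type variables replaced by `B -> B`. -/
def Ty.endo : Ty → Ty → Ty
  | .var _, B => .lolli B B
  | .tensor X Y, B => .tensor (X.endo B) (Y.endo B)
  | .lolli X Y, B => .lolli (X.endo B) (Y.endo B)

theorem Ty.subst_eq_endo (A B : Ty) : (A.subst fun _ => Ty.lolli B B) = A.endo B := by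
  induction A with
  | var a => rfl
  | tensor X Y ihX ihY => rw [Ty.subst, ihX, ihY, Ty.endo]
  | lolli X Y ihX ihY => rw [Ty.subst, ihX, ihY, Ty.endo]

mutual

/-- A closed term that maps closed terms of `A` to the identity. -/
def Ty.eraser : Ty → Tm
  | .var _ => idTm
  -- Index `0` is bound by `comp`, so the two components sit at `1` and `2`.
  | .tensor A B => Tm.lam (Tm.letp (Tm.var 0)
      (comp (Tm.app A.eraser (Tm.var 1)) (Tm.app B.eraser (Tm.var 2))))
  | .lolli A B => Tm.lam (Tm.app B.eraser (Tm.app (Tm.var 0) (Tm.app A.filler idTm)))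

/-- A closed term that maps the identity to a closed term of `A`. -/
def Ty.filler : Ty → Tm
  | .var _ => idTm
  -- By linearity the argument can fill only one component; the other gets a fresh identity.
  | .tensor A B => Tm.lam (Tm.pair (Tm.app A.filler (Tm.var 0)) (Tm.app B.filler idTm))
  -- Both the given endomorphism and the erased argument must be consumed, hence their composite is
  -- what fills the result type.
  | .lolli A B => Tm.lam (Tm.lam (Tm.app B.filler
      (comp (Tm.var 2) (Tm.app A.eraser (Tm.var 1)))))

end

theorem hasType_eraser_tensor_body {B X Y : Ty}
    (eX : ClosedOf X.eraser (Ty.lolli (X.endo B) (Ty.lolli B B)))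
    (eY : ClosedOf Y.eraser (Ty.lolli (Y.endo B) (Ty.lolli B B))) :
    HasType (Ctx.cons (X.endo B) (Ctx.cons (Y.endo B) Ctx.empty))
      (comp (Tm.app X.eraser (Tm.var 1)) (Tm.app Y.eraser (Tm.var 2))) (Ty.lolli B B) := by
  refine hasType_comp (Γ := Ctx.single 1 (X.endo B)) (Δ := Ctx.single 2 (Y.endo B))
    (Ξ := fun i => match i with
      | 0 => none
      | i + 1 => Ctx.cons (X.endo B) (Ctx.cons (Y.endo B) Ctx.empty) i) ?_ rfl
    (.app (Ctx.merge_empty_left _) eX (.var 1 _)) (.app (Ctx.merge_empty_left _) eY (.var 2 _))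
  intro i
  match i with
  | 0 => exact Or.inl ⟨rfl, rfl⟩
  | 1 => exact Or.inr ⟨rfl, rfl⟩
  | 2 => exact Or.inl ⟨rfl, rfl⟩
  | i + 3 => exact Or.inl ⟨rfl, rfl⟩

/-- The terms depend on `A` alone and are typable for every `B`; the mutual recursion forces a
simultaneous induction. -/
theorem closedOf_eraser_filler (B A : Ty) :
    ClosedOf A.eraser (Ty.lolli (A.endo B) (Ty.lolli B B)) ∧
      ClosedOf A.filler (Ty.lolli (Ty.lolli B B) (A.endo B)) := by
  induction A with
  | var a => exact ⟨closedOf_idTm _, closedOf_idTm _⟩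
  | tensor X Y ihX ihY =>
    obtain ⟨eX, fX⟩ := ihX
    obtain ⟨eY, fY⟩ := ihY
    constructor
    · refine .lam ?_
      rw [Ctx.cons_empty]
      refine .letp (Ctx.merge_empty_right _) (.var 0 _) (A := X.endo B) (B := Y.endo B)
        (hasType_eraser_tensor_body eX eY)
    · refine .lam ?_
      rw [Ctx.cons_empty]
      exact .pair (Ctx.merge_empty_right _) (.app (Ctx.merge_empty_left _) fX (.var 0 _))
        (fY.app (closedOf_idTm B))
  | lolli X Y ihX ihY =>
    obtain ⟨eX, fX⟩ := ihX
    obtain ⟨eY, fY⟩ := ihY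
    constructor
    · refine .lam ?_
      rw [Ctx.cons_empty]
      exact .app (Ctx.merge_empty_left _) eY
        (.app (Ctx.merge_empty_right _) (.var 0 _) (fX.app (closedOf_idTm B)))
    · refine .lam (.lam (.app (Ctx.merge_empty_left _) fY ?_))
      refine hasType_comp (Γ := Ctx.single 2 (Ty.lolli B B)) (Δ := Ctx.single 1 (X.endo B))
        (Ξ := fun i => match i with
          | 0 => none
          | i + 1 => Ctx.cons (X.endo B) (Ctx.cons (Ty.lolli B B) Ctx.empty) i) ?_ rfl
        (.var 2 _) (.app (Ctx.merge_empty_left _) eX (.var 1 _))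
      intro i
      match i with
      | 0 => exact Or.inl ⟨rfl, rfl⟩
      | 1 => exact Or.inl ⟨rfl, rfl⟩
      | 2 => exact Or.inr ⟨rfl, rfl⟩
      | i + 3 => exact Or.inl ⟨rfl, rfl⟩

theorem closedOf_eraser (B A : Ty) : ClosedOf A.eraser (Ty.lolli (A.endo B) (Ty.lolli B B)) :=
  (closedOf_eraser_filler B A).1

theorem closedOf_filler (B A : Ty) : ClosedOf A.filler (Ty.lolli (Ty.lolli B B) (A.endo B)) :=
  (closedOf_eraser_filler B A).2

@[simp]
theorem subst_eraser (A : Ty) (σ : ℕ → Tm) : A.eraser.subst σ = A.eraser :=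
  (closedOf_eraser A A).subst_eq σ

@[simp]
theorem subst_filler (A : Ty) (σ : ℕ → Tm) : A.filler.subst σ = A.filler :=
  (closedOf_filler A A).subst_eq σ

@[simp]
theorem subst_idTm (σ : ℕ → Tm) : idTm.subst σ = idTm := rfl

-- The logical relation and its fundamental lemma

/-- The logical relation on closed terms of `A.endo B` whose base relation is equality to the
identity. -/
def Red (B : Ty) : Ty → Tm → Prop
  | .var _, t => ClosedOf t (Ty.lolli B B) ∧ EqBetaEtaC Ctx.empty t idTm (Ty.lolli B B)
  -- Equality to a pair is built into the relation, so no normalization theorem is needed to expose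
  -- one.
  | .tensor X Y, t => ClosedOf t ((Ty.tensor X Y).endo B) ∧
      ∃ u v, Red B X u ∧ Red B Y v ∧
        EqBetaEtaC Ctx.empty t (Tm.pair u v) ((Ty.tensor X Y).endo B)
  | .lolli X Y, t => ClosedOf t ((Ty.lolli X Y).endo B) ∧
      ∀ u, Red B X u → Red B Y (Tm.app t u)

theorem Red.closedOf {B A : Ty} {t : Tm} (h : Red B A t) : ClosedOf t (A.endo B) := by
  cases A with
  | var a => exact h.1
  | tensor X Y => exact h.1
  | lolli X Y => exact h.1

/-- At implications the equality is carried through application by congruence; at variables and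
tensors transitivity suffices. -/
theorem Red.expand {B A : Ty} : ∀ {t t' : Tm}, Red B A t' → ClosedOf t (A.endo B) →
    EqBetaEtaC Ctx.empty t t' (A.endo B) → Red B A t := by
  induction A with
  | var a => exact fun h ht he => ⟨ht, he.trans h.2⟩
  | tensor X Y _ _ =>
    intro t t' h ht he
    obtain ⟨_, u, v, hu, hv, he'⟩ := h
    exact ⟨ht, u, v, hu, hv, he.trans he'⟩
  | lolli X Y _ ihY =>
    intro t t' h ht he
    exact ⟨ht, fun u hu => ihY (h.2 u hu) (ClosedOf.app ht hu.closedOf)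
      (he.appClosed (.refl hu.closedOf))⟩

theorem Red.tensor_of {B X Y : Ty} {u v : Tm} (hu : Red B X u) (hv : Red B Y v) :
    Red B (.tensor X Y) (Tm.pair u v) :=
  have h : ClosedOf (Tm.pair u v) ((Ty.tensor X Y).endo B) :=
    .pair (Ctx.merge_empty_left _) hu.closedOf hv.closedOf
  ⟨h, u, v, hu, hv, .refl h⟩

/-- The fundamental lemma: instances of typed terms by related closed terms are related. -/
theorem HasType.red {B : Ty} {Γ : Ctx} {t : Tm} {A : Ty} (h : HasType Γ t A) :
    ∀ σ : ℕ → Tm, (∀ i X, Γ i = some X → Red B X (σ i)) → Red B A (t.subst σ) := by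
  have closed : ∀ {Γ : Ctx} {σ : ℕ → Tm}, (∀ i X, Γ i = some X → Red B X (σ i)) →
      ∀ i X, Γ.subst (fun _ => Ty.lolli B B) i = some X → ClosedOf (σ i) X := by
    intro Γ σ hσ i X hi
    obtain ⟨X', hX', rfl⟩ := Option.map_eq_some_iff.1 hi
    rw [Ty.subst_eq_endo]
    exact (hσ i X' hX').closedOf
  have typing : ∀ {Γ : Ctx} {t : Tm} {A : Ty} {σ : ℕ → Tm}, HasType Γ t A →
      (∀ i X, Γ i = some X → Red B X (σ i)) → ClosedOf (t.subst σ) (A.endo B) := by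
    intro Γ t A σ h hσ
    rw [← Ty.subst_eq_endo]
    exact (h.substTy fun _ => Ty.lolli B B).subst_closed σ (closed hσ)
  have hcons : ∀ {Γ : Ctx} {X : Ty} {u : Tm} {σ : ℕ → Tm}, Red B X u →
      (∀ i X, Γ i = some X → Red B X (σ i)) →
      ∀ i X', Ctx.cons X Γ i = some X' → Red B X' (Tm.scons u σ i) := by
    intro Γ X u σ hu hσ i X' hi
    cases i with
    | zero => cases hi; exact hu
    | succ i => exact hσ i X' hi
  induction h with
  | var i A => exact fun σ hσ => hσ i A (by simp [Ctx.single])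
  | lam h ih =>
    intro σ hσ
    have ht := typing (.lam h) hσ
    refine ⟨ht, fun u hu => ?_⟩
    have happ := ClosedOf.app ht hu.closedOf
    exact (ih _ (hcons hu hσ)).expand happ (.beta happ (Tm.inst1_subst_liftSub _ _ _))
  | app hm _ _ ih1 ih2 =>
    intro σ hσ
    exact (ih1 σ fun i X hi => hσ i X (hm.left hi)).2 _
      (ih2 σ fun i X hi => hσ i X (hm.right hi))
  | pair hm _ _ ih1 ih2 =>
    intro σ hσ
    exact (ih1 σ fun i X hi => hσ i X (hm.left hi)).tensor_of
      (ih2 σ fun i X hi => hσ i X (hm.right hi))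
  | @letp Γ Δ Ξ s t X Y C hm h1 h2 ih1 ih2 =>
    intro σ hσ
    have hσ2 : ∀ i X, Δ i = some X → Red B X (σ i) := fun i X hi => hσ i X (hm.right hi)
    have hlet := typing (.letp hm h1 h2) hσ
    -- The scrutinee equals a pair of related terms, so the `let` reduces by β₂ without commutative
    -- conversions.
    obtain ⟨_, u, v, hu, hv, he⟩ := ih1 σ fun i X hi => hσ i X (hm.left hi)
    have hbody : HasType (Ctx.cons (X.endo B) (Ctx.cons (Y.endo B) Ctx.empty))
        (t.subst (Tm.liftSub (Tm.liftSub σ))) (C.endo B) := by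
      have := h2.substTy fun _ => Ty.lolli B B
      rw [Ctx.subst_cons, Ctx.subst_cons] at this
      simpa only [Ty.subst_eq_endo] using this.subst_closed_two σ (closed hσ2)
    have hpair := (hu.tensor_of hv).closedOf
    refine (ih2 _ (hcons hu (hcons hv hσ2))).expand hlet ?_
    rw [← Tm.inst2_subst_liftSub]
    exact (EqBetaEtaC.letp (Ctx.merge_empty_left _) he (.refl hbody)).trans
      (.of_rootStep (.letp (Ctx.merge_empty_left _) hpair hbody) (.beta2 _ _ _))

theorem ClosedOf.red {t : Tm} {A : Ty} (h : ClosedOf t A) (B : Ty) : Red B A t := by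
  have := HasType.red (B := B) h Tm.var fun _ _ hi => nomatch hi
  rwa [h.subst_eq] at this

/-- The two halves need each other at implications: erasing a function applies it to a filler, which
must be related, and filling a function erases its argument, which must yield the identity. -/
theorem eraser_filler_spec (B A : Ty) :
    (∀ t, Red B A t →
      EqBetaEtaC Ctx.empty (Tm.app A.eraser t) idTm (Ty.lolli B B)) ∧
    ∀ w, ClosedOf w (Ty.lolli B B) → EqBetaEtaC Ctx.empty w idTm (Ty.lolli B B) →
      Red B A (Tm.app A.filler w) := by
  induction A with
  | var a =>
    constructor
    · intro t ht
      exact (EqBetaEtaC.beta ((closedOf_idTm _).app ht.1) rfl).trans ht.2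
    · intro w hw he
      have := (closedOf_idTm _).app hw
      exact ⟨this, (EqBetaEtaC.beta this rfl).trans he⟩
  | tensor X Y ihX ihY =>
    obtain ⟨eX, fX⟩ := ihX
    obtain ⟨eY, fY⟩ := ihY
    have cE := closedOf_eraser B (.tensor X Y)
    have cF := closedOf_filler B (.tensor X Y)
    constructor
    · intro t ht
      obtain ⟨ct, u, v, hu, hv, he⟩ := ht
      have cp := (hu.tensor_of hv).closedOf
      have h1 := (EqBetaEtaC.refl cE).appClosed he
      have hb := hasType_eraser_tensor_body (closedOf_eraser B X) (closedOf_eraser B Y)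
      have h2 : EqBetaEtaC Ctx.empty (Tm.app (Ty.tensor X Y).eraser (Tm.pair u v))
          (Tm.letp (Tm.pair u v) (comp (Tm.app X.eraser (Tm.var 1)) (Tm.app Y.eraser (Tm.var 2))))
          (Ty.lolli B B) :=
        EqBetaEtaC.beta (cE.app cp) (by simp [Tm.inst1, Tm.subst, comp, Tm.liftSub, Tm.rename])
      have h3 := EqBetaEtaC.of_rootStep (HasType.letp (Ctx.merge_empty_left _) cp hb)
        (.beta2 _ _ _)
      have h4 : (comp (Tm.app X.eraser (Tm.var 1)) (Tm.app Y.eraser (Tm.var 2))).inst2 u v =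
          comp (Tm.app X.eraser u) (Tm.app Y.eraser v) := by
        simp [Tm.inst2, Tm.subst, comp, Tm.liftSub, hu.closedOf.rename_eq, hv.closedOf.rename_eq]
      rw [h4] at h3
      exact ((h1.trans h2).trans h3).trans ((eX u hu).comp_idTm (eY v hv))
    · intro w hw he
      have happ := cF.app hw
      refine ((fX w hw he).tensor_of (fY idTm (closedOf_idTm B) (.refl (closedOf_idTm B)))).expand
        happ (.beta happ ?_)
      simp [Tm.inst1, Tm.subst]
  | lolli X Y ihX ihY =>
    obtain ⟨eX, fX⟩ := ihX
    obtain ⟨eY, fY⟩ := ihY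
    have cE := closedOf_eraser B (.lolli X Y)
    have cF := closedOf_filler B (.lolli X Y)
    constructor
    · intro t ht
      refine (EqBetaEtaC.beta (cE.app ht.1) ?_).trans
        (eY _ (ht.2 _ (fX idTm (closedOf_idTm B) (.refl (closedOf_idTm B)))))
      simp [Tm.inst1, Tm.subst]
    · intro w hw he
      have cFw := cF.app hw
      refine ⟨cFw, fun u hu => ?_⟩
      have ceu := (closedOf_eraser B X).app hu.closedOf
      have happ := cFw.app hu.closedOf
      -- Applied to `w` and `u`, the filler reduces to `Y.filler` of `w` composed with the erased
      -- `u`, and both factors equal the identity.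
      refine (fY (comp w (Tm.app X.eraser u)) (hw.comp ceu) (he.comp_idTm (eX u hu))).expand
        happ ?_
      have hb : HasType (Ctx.single 0 (X.endo B))
          (Tm.app Y.filler (comp w (Tm.app X.eraser (Tm.var 1)))) (Y.endo B) := by
        refine .app (Ctx.merge_empty_left _) (closedOf_filler B Y) ?_
        have := hasType_comp (Ctx.merge_empty_left _) rfl hw (HasType.app
          (Ctx.merge_empty_left _) (closedOf_eraser B X) (HasType.var 1 (X.endo B)))
        convert this using 1
        funext i
        cases i <;> simp [Ctx.single]
      rw [← Ctx.cons_empty] at hb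
      have h1 : EqBetaEtaC Ctx.empty (Tm.app (Ty.lolli X Y).filler w)
          (Tm.lam (Tm.app Y.filler (comp w (Tm.app X.eraser (Tm.var 1)))))
          ((Ty.lolli X Y).endo B) :=
        .beta cFw (by simp [Tm.subst, comp, Tm.liftSub, Tm.inst1, Tm.rename, hw.rename_eq])
      refine (h1.appClosed (.refl hu.closedOf)).trans
        (.beta (ClosedOf.app (.lam hb) hu.closedOf) ?_)
      simp [Tm.subst, comp, Tm.liftSub, Tm.inst1, hw.subst_eq, hu.closedOf.rename_eq]

/-! ### Constant functions -/

/-- The constant function with value `u`, defined on the closed terms of `A`. -/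
def constFun (A : Ty) (u : Tm) : Tm := Tm.lam (Tm.app (Tm.app A.eraser (Tm.var 0)) u)

theorem closedOf_constFun (A : Ty) {B : Ty} {u : Tm} (hu : ClosedOf u B) :
    ClosedOf (constFun A u) (Ty.lolli (A.endo B) B) := by
  refine .lam ?_
  rw [Ctx.cons_empty]
  exact .app (Ctx.merge_empty_right _)
    (.app (Ctx.merge_empty_left _) (closedOf_eraser B A) (.var 0 _)) hu

theorem ClosedOf.endo {s : Tm} {A : Ty} (hs : ClosedOf s A) (B : Ty) :
    ClosedOf s (A.endo B) := by
  rw [← Ty.subst_eq_endo]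
  exact hs.substTy _

theorem constFun_app_eq {A B : Ty} {u s : Tm} (hu : ClosedOf u B) (hs : ClosedOf s A) :
    EqBetaEtaC Ctx.empty (Tm.app (constFun A u) s) u B := by
  have h1 : EqBetaEtaC Ctx.empty (Tm.app (constFun A u) s) (Tm.app (Tm.app A.eraser s) u) B :=
    .beta ((closedOf_constFun A hu).app (hs.endo B)) (by
      simp [Tm.inst1, Tm.subst, hu.subst_eq])
  have h2 := ((eraser_filler_spec B A).1 s (hs.red B)).appClosed (.refl hu)
  exact (h1.trans h2).trans (.beta ((closedOf_idTm B).app hu) rfl)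

/-- Since principal types can be renamed apart, it suffices that the types `As₀` accepted by `t` are
also types of the arguments; they may differ from `As`. -/
theorem polyTypableN_of_closedOf {t : Tm} {ss : List Tm} {As As₀ : List Ty} {B : Ty}
    (ht : ClosedOf t (Ty.arrows As₀ B)) (hs : List.Forall₂ ClosedOf ss As)
    (hs₀ : List.Forall₂ ClosedOf ss As₀) : PolyTypableN t As B ss := by
  obtain ⟨Ps, θ, h1, h2⟩ := exists_principalTypes_subst (.cons ht hs₀)
  cases h1 with
  | cons hP hQs =>
    rw [List.map_cons, List.cons.injEq] at h2
    exact ⟨⟨As₀, B, hs₀.length_eq.symm.trans hs.length_eq, ht⟩, hs, _, _, As₀, θ, hP, hQs, h2⟩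

theorem PolyTypableN.polyTypable {t s : Tm} {A B : Ty} (h : PolyTypableN t [A] B [s]) :
    PolyTypable t A B s := by
  obtain ⟨⟨As', B', hlen, ht⟩, hs, P, Qs, As₀, θ, hP, hQs, h1, h2⟩ := h
  obtain ⟨A', rfl⟩ := List.length_eq_one_iff.1 hlen
  cases hs with
  | cons hs _ =>
    cases hQs with
    | cons hQ hnil =>
      cases hnil
      subst h2
      exact ⟨⟨A', B', ht⟩, hs, P, _, _, θ, hP, hQ, h1, rfl⟩

/-- Equal functions have equal values. -/
theorem EqBetaEtaC.apps {ss : List Tm} {As : List Ty} (hs : List.Forall₂ ClosedOf ss As) :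
    ∀ {t t' : Tm} {B : Ty}, EqBetaEtaC Ctx.empty t t' (Ty.arrows As B) →
      EqBetaEtaC Ctx.empty (t.apps ss) (t'.apps ss) B := by
  induction hs with
  | nil => exact fun h => h
  | cons hs _ ih => exact fun h => ih (h.appClosed (.refl hs))

/-- The constant function of `n` arguments with value `v`. -/
theorem exists_constFunN (A : Ty) {v : Tm} {B : Ty} (hv : ClosedOf v B) (n : ℕ) :
    ∃ (t : Tm) (As₀ : List Ty), ClosedOf t (Ty.arrows As₀ B) ∧
      ∀ ss : List Tm, ss.length = n → (∀ s ∈ ss, ClosedOf s A) →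
        List.Forall₂ ClosedOf ss As₀ ∧ EqBetaEtaC Ctx.empty (t.apps ss) v B := by
  induction n with
  | zero =>
    refine ⟨v, [], hv, fun ss hlen _ => ?_⟩
    obtain rfl := List.length_eq_zero_iff.1 hlen
    exact ⟨.nil, .refl hv⟩
  | succ n ih =>
    obtain ⟨t, As₀, ht, h⟩ := ih
    -- The value on the first argument is the constant function of the remaining ones, so each
    -- argument gets its own instance of `A`.
    refine ⟨constFun A t, A.endo (Ty.arrows As₀ B) :: As₀,
      closedOf_constFun A ht, fun ss hss hs => ?_⟩
    cases ss with
    | nil => cases hss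
    | cons s ss =>
      obtain ⟨h1, h2⟩ := h ss (by simpa using hss) fun s' hs' => hs s' (List.mem_cons_of_mem _ hs')
      have hsA := hs s List.mem_cons_self
      exact ⟨.cons (hsA.endo _) h1, ((constFun_app_eq ht hsA).apps h1).trans h2⟩

end LinLam

theorem mainTheorem5 :
    (∀ (A B : LinLam.Ty), A.HasClosedTerm → B.HasClosedTerm →
      ∀ u : LinLam.Tm, LinLam.ClosedOf u B →
        ∃ t : LinLam.Tm, (∃ T, LinLam.ClosedOf t T) ∧
          ∀ s : LinLam.Tm, LinLam.ClosedOf s A →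
            LinLam.PolyTypable t A B s ∧
            LinLam.EqBetaEtaC LinLam.Ctx.empty (LinLam.Tm.app t s) u B) ∧
    (∀ A : LinLam.Ty, ∀ v : LinLam.Tm, LinLam.ClosedOf v A →
      ∀ n : ℕ, ∃ t : LinLam.Tm, (∃ T, LinLam.ClosedOf t T) ∧
        ∀ ss : List LinLam.Tm, ss.length = n → (∀ s ∈ ss, LinLam.ClosedOf s A) →
          LinLam.PolyTypableN t (List.replicate n A) A ss ∧
          LinLam.EqBetaEtaC LinLam.Ctx.empty (t.apps ss) v A) := by
  constructor
  · intro A B _ _ u hu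
    have ht := LinLam.closedOf_constFun A hu
    refine ⟨LinLam.constFun A u, ⟨_, ht⟩, fun s hs => ⟨?_, LinLam.constFun_app_eq hu hs⟩⟩
    exact (LinLam.polyTypableN_of_closedOf (As₀ := [A.endo B]) ht (.cons hs .nil)
      (.cons (hs.endo B) .nil)).polyTypable
  · intro A v hv n
    obtain ⟨t, As₀, ht, h⟩ := LinLam.exists_constFunN A hv n
    refine ⟨t, ⟨_, ht⟩, fun ss hlen hs => ?_⟩
    obtain ⟨h1, h2⟩ := h ss hlen hs
    refine ⟨LinLam.polyTypableN_of_closedOf ht ?_ h1, h2⟩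
    subst hlen
    rw [List.forall₂_iff_get]
    simpa using fun i hi => hs _ (List.getElem_mem hi)
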